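/- Let $R$ be an associative ring with identity, and let $J(R)$ be its Jacobson radical. A right coprime pair $\langle a,b\rangle$ of $R$ is the class of a pair $(a,b)\in R^2$ with $aR+bR=R$, where $(a,b)$ and $(a',b')$ are identified (and both are called generators of the class) if $aR=a'R$ and $bR=b'R$. The set $\mathrm{RCP}(R)$ of these classes is partially ordered by $\langle a,b\rangle\le\langle a',b'\rangle$ if and only if $aR\subseteq a'R$ and $bR\subseteq b'R$. A descending chain $\{p_\alpha\mid\alpha<\kappa\}$ in $\mathrm{RCP}(R)$, indexed by an ordinal $\kappa$, is called compatible if there are generators $(a_\alpha,b_\alpha)$ of $p_\alpha$ and elements $r_{\alpha\beta},s_{\alpha\beta}\in R$ for $\alpha<\beta<\kappa$ such that $a_\beta=a_\alpha r_{\alpha\beta}$ and $b_\beta=b_\alpha s_{\alpha\beta}$ for all $\alpha<\beta<\kappa$, and $r_{\alpha\beta}=r_{\alpha\gamma}r_{\gamma\beta}$ and $s_{\alpha\beta}=s_{\alpha\gamma}s_{\gamma\beta}$ for all $\alpha<\gamma<\beta<\kappa$. The ring $R$ is called right strongly exchange if every compatible descending chain of right coprime pairs has a lower bound that is a minimal element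 of $\mathrm{RCP}(R)$. Theorem. If $R$ is a right strongly exchange ring with only countably many idempotents, then $R$ is semiperfect, that is, $R/J(R)$ is semisimple and every idempotent of $R/J(R)$ lifts to an idempotent of $R$. -/

import Mathlib

universe u

/-- The principal right ideal `aR` of a ring `R`, as a submodule of the right module `R_R`
(right `R`-modules are modules over `Rᵐᵒᵖ`). -/
def principalRightIdeal {R : Type u} [Ring R] (a : R) : Submodule Rᵐᵒᵖ R :=
  Submodule.span Rᵐᵒᵖ {a}

/-- `x ∈ aR` if and only if `x = a * r` for some `r`. -/
theorem mem_principalRightIdeal {R : Type u} [Ring R] {a x : R} :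
    x ∈ principalRightIdeal a ↔ ∃ r : R, x = a * r := by
  rw [principalRightIdeal, Submodule.mem_span_singleton]
  constructor
  · rintro ⟨r, rfl⟩
    exact ⟨r.unop, rfl⟩
  · rintro ⟨r, rfl⟩
    exact ⟨MulOpposite.op r, rfl⟩

/-- A pair of elements `(a, b)` of `R` with `aR + bR = R`. -/
structure RightCoprimePair (R : Type u) [Ring R] where
  /-- The first entry. -/
  a : R
  /-- The second entry. -/
  b : R
  /-- `aR + bR = R`. -/
  coprime : principalRightIdeal a ⊔ principalRightIdeal b = ⊤

/-- `(a, b) ≤ (a', b')` if and only if `aR ≤ a'R` and `bR ≤ b'R`. -/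
instance RightCoprimePair.instPreorder (R : Type u) [Ring R] : Preorder (RightCoprimePair R) where
  le p q := principalRightIdeal p.a ≤ principalRightIdeal q.a ∧
    principalRightIdeal p.b ≤ principalRightIdeal q.b
  le_refl _ := ⟨le_rfl, le_rfl⟩
  le_trans _ _ _ h h' := ⟨h.1.trans h'.1, h.2.trans h'.2⟩

/-- The partially ordered set `RCP(R)` of right coprime pairs `⟨a, b⟩`, where two pairs of
generators `(a, b)` and `(a', b')` are identified if and only if `aR = a'R` and `bR = b'R`;
the order is `⟨a, b⟩ ≤ ⟨a', b'⟩` if and only if `aR ≤ a'R` and `bR ≤ b'R`. -/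
abbrev RCP (R : Type u) [Ring R] : Type u :=
  Antisymmetrization (RightCoprimePair R) (· ≤ ·)

/-- The class `⟨a, b⟩` in `RCP(R)` of a pair of generators `(a, b)`. -/
def RightCoprimePair.toRCP {R : Type u} [Ring R] (p : RightCoprimePair R) : RCP R :=
  toAntisymmetrization (· ≤ ·) p

/-- Two pairs of generators give the same element of `RCP(R)` if and only if they generate the
same right ideals. -/
theorem RightCoprimePair.toRCP_eq_iff {R : Type u} [Ring R] {p q : RightCoprimePair R} :
    p.toRCP = q.toRCP ↔ principalRightIdeal p.a = principalRightIdeal q.a ∧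
      principalRightIdeal p.b = principalRightIdeal q.b := by
  refine Quotient.eq.trans ⟨fun h => ?_, fun h => ?_⟩
  · exact ⟨le_antisymm h.1.1 h.2.1, le_antisymm h.1.2 h.2.2⟩
  · exact ⟨⟨h.1.le, h.2.le⟩, ⟨h.1.ge, h.2.ge⟩⟩

/-- The order of `RCP(R)` in terms of generators. -/
theorem RightCoprimePair.toRCP_le_iff {R : Type u} [Ring R] {p q : RightCoprimePair R} :
    p.toRCP ≤ q.toRCP ↔ principalRightIdeal p.a ≤ principalRightIdeal q.a ∧
      principalRightIdeal p.b ≤ principalRightIdeal q.b :=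
  Iff.rfl

/-- A compatible descending chain of right coprime pairs: a descending family `p` for which there
are generators `(a_i, b_i)` of `p_i` and scalars `r_{ij}`, `s_{ij}` (`i < j`) such that
`a_j = a_i r_{ij}`, `b_j = b_i s_{ij}` for `i < j`, and `r_{ik} = r_{ij} r_{jk}`,
`s_{ik} = s_{ij} s_{jk}` for `i < j < k`. -/
def IsCompatibleDescendingChain {R : Type u} [Ring R] {ι : Type u} [LinearOrder ι]
    (p : ι → RCP R) : Prop :=
  Antitone p ∧
    ∃ (g : ι → RightCoprimePair R) (r s : ι → ι → R),
      (∀ i, (g i).toRCP = p i) ∧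
      (∀ i j, i < j → (g j).a = (g i).a * r i j ∧ (g j).b = (g i).b * s i j) ∧
      (∀ i j k, i < j → j < k → r i k = r i j * r j k ∧ s i k = s i j * s j k)

/-- A ring is right strongly exchange if every compatible descending chain of right coprime pairs,
indexed by an ordinal (that is, by a well-ordered type), has a lower bound which is a minimal
element of `RCP(R)`. Well-orders in the universe of `R` suffice: the lower bounds of a chain
depend only on its set of values, and choosing the least index of each value gives a compatible
subchain whose index set embeds in `RCP(R)`. -/
def IsRightStronglyExchange (R : Type u) [Ring R] : Prop :=
  ∀ (ι : Type u) [LinearOrder ι] [WellFoundedLT ι] (p : ι → RCP R),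
    IsCompatibleDescendingChain p → ∃ q : RCP R, (∀ i, q ≤ p i) ∧ IsMin q

/-- A ring is semiperfect if `R/J(R)` is semisimple and every idempotent of `R/J(R)` is the image
of an idempotent of `R`, where `J(R)` is the Jacobson radical. -/
structure IsSemiperfectRing (R : Type u) [Ring R] : Prop where
  isSemisimpleRing_quotient : IsSemisimpleRing (R ⧸ Ring.jacobson R)
  exists_idempotent_lift : ∀ x : R ⧸ Ring.jacobson R, IsIdempotentElem x →
    ∃ e : R, IsIdempotentElem e ∧ Ideal.Quotient.mk (Ring.jacobson R) e = x

variable {R : Type u} [Ring R]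

/-! A minimal element of `RCP(R)` is given by complementary idempotents, so a compatible chain
always has a pair `(e, 1 - e)` below it. One-element chains give the exchange property, hence
lifting of idempotents and, outside `J(R)`, nonzero idempotent multiples. For orthogonal nonzero
idempotents `f i` and `A ⊆ ℕ`, the chain of pairs `1 - ∑ f i`, summed over `i < n` in `A` and in its
complement, gives an idempotent that determines `A` (`exists_separating`). There are uncountably
many `A`, so countability forces the ascending chain condition on idempotents. A maximal idempotent
of a left ideal then generates it modulo `J(R)`, so `R/J(R)` is semisimple. -/

theorem mul_mem_principalRightIdeal (a r : R) : a * r ∈ principalRightIdeal a :=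
  mem_principalRightIdeal.2 ⟨r, rfl⟩

theorem self_mem_principalRightIdeal (a : R) : a ∈ principalRightIdeal a :=
  mem_principalRightIdeal.2 ⟨1, (mul_one a).symm⟩

theorem principalRightIdeal_le_iff {a b : R} :
    principalRightIdeal a ≤ principalRightIdeal b ↔ ∃ r, a = b * r := by
  rw [principalRightIdeal, Submodule.span_singleton_le_iff_mem, mem_principalRightIdeal]

theorem mul_eq_zero_of_mem_principalRightIdeal {x a y : R} (h : x * a = 0)
    (hy : y ∈ principalRightIdeal a) : x * y = 0 := by
  obtain ⟨r, rfl⟩ := mem_principalRightIdeal.1 hy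
  rw [← mul_assoc, h, zero_mul]

theorem principalRightIdeal_sup_eq_top_iff {a b : R} :
    principalRightIdeal a ⊔ principalRightIdeal b = ⊤ ↔ ∃ r s, a * r + b * s = 1 := by
  constructor
  · intro h
    have h1 : (1 : R) ∈ principalRightIdeal a ⊔ principalRightIdeal b := h ▸ Submodule.mem_top
    obtain ⟨y, hy, z, hz, hyz⟩ := Submodule.mem_sup.1 h1
    obtain ⟨r, rfl⟩ := mem_principalRightIdeal.1 hy
    obtain ⟨s, rfl⟩ := mem_principalRightIdeal.1 hz
    exact ⟨r, s, hyz⟩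
  · rintro ⟨r, s, h⟩
    refine eq_top_iff.2 fun x _ => ?_
    have hx : x = a * (r * x) + b * (s * x) := by
      rw [← mul_assoc, ← mul_assoc, ← add_mul, h, one_mul]
    rw [hx]
    exact Submodule.add_mem_sup (mul_mem_principalRightIdeal _ _) (mul_mem_principalRightIdeal _ _)

/-- A pair of elements with sum `1`, as a right coprime pair. -/
def RightCoprimePair.ofAddEqOne (a b : R) (h : a + b = 1) : RightCoprimePair R where
  a := a
  b := b
  coprime := principalRightIdeal_sup_eq_top_iff.2 ⟨1, 1, by rwa [mul_one, mul_one]⟩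

/-- A coprime pair below a minimal pair generates the same right ideals. -/
theorem RightCoprimePair.mem_of_isMin {p : RightCoprimePair R} (hp : IsMin p.toRCP) {x y r s : R}
    (hx : x = p.a * r) (hy : y = p.b * s) (hxy : ∃ t u, x * t + y * u = 1) :
    p.a ∈ principalRightIdeal x ∧ p.b ∈ principalRightIdeal y := by
  let q : RightCoprimePair R := ⟨x, y, principalRightIdeal_sup_eq_top_iff.2 hxy⟩
  have hqp : q.toRCP ≤ p.toRCP := RightCoprimePair.toRCP_le_iff.2
    ⟨principalRightIdeal_le_iff.2 ⟨r, hx⟩, principalRightIdeal_le_iff.2 ⟨s, hy⟩⟩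
  have hpq := RightCoprimePair.toRCP_le_iff.1 (hp hqp)
  exact ⟨hpq.1 (self_mem_principalRightIdeal _), hpq.2 (self_mem_principalRightIdeal _)⟩

/-- Minimality is tested on two smaller pairs. `(a², 1 - a)` gives `a = a²c`; then `(ac, 1 - ac)`
gives `1 - a ∈ (1 - ac)R`, which `a` annihilates from the left. -/
theorem RightCoprimePair.isIdempotentElem_of_isMin {p : RightCoprimePair R} (hp : IsMin p.toRCP)
    (h1 : p.a + p.b = 1) : IsIdempotentElem p.a := by
  obtain ⟨a, b, hab⟩ := p
  change a + b = 1 at h1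
  obtain rfl : b = 1 - a := eq_sub_of_add_eq' h1
  obtain ⟨c, hc⟩ := mem_principalRightIdeal.1 (RightCoprimePair.mem_of_isMin hp (x := a * a)
    (y := 1 - a) (r := a) (s := 1) rfl (mul_one _).symm ⟨1, 1 + a, by noncomm_ring⟩).1
  change a = a * a * c at hc
  have h0 : a * (1 - a * c) = 0 := by rw [mul_sub, mul_one, ← mul_assoc, ← hc, sub_self]
  have h2 := (RightCoprimePair.mem_of_isMin hp (x := a * c) (y := 1 - a * c) (r := c)
    (s := 1 - a * c) rfl (by rw [sub_mul, one_mul, h0, sub_zero]) ⟨1, 1, by noncomm_ring⟩).2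
  have h3 : a * (1 - a) = 0 := mul_eq_zero_of_mem_principalRightIdeal h0 h2
  rw [mul_sub, mul_one, sub_eq_zero] at h3
  exact h3.symm

/-- The minimal elements of `RCP(R)` are the classes of complementary idempotents. -/
theorem RCP.exists_isIdempotentElem_of_isMin {p : RightCoprimePair R} (hp : IsMin p.toRCP) :
    ∃ e, IsIdempotentElem e ∧ e ∈ principalRightIdeal p.a ∧ 1 - e ∈ principalRightIdeal p.b := by
  obtain ⟨r, s, h⟩ := principalRightIdeal_sup_eq_top_iff.1 p.coprime
  let q := RightCoprimePair.ofAddEqOne (p.a * r) (p.b * s) h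
  have hqp : q.toRCP ≤ p.toRCP := RightCoprimePair.toRCP_le_iff.2
    ⟨principalRightIdeal_le_iff.2 ⟨r, rfl⟩, principalRightIdeal_le_iff.2 ⟨s, rfl⟩⟩
  refine ⟨p.a * r, RightCoprimePair.isIdempotentElem_of_isMin (p := q) (hp.mono hqp) h,
    mul_mem_principalRightIdeal _ _, ?_⟩
  rw [← h, add_sub_cancel_left]
  exact mul_mem_principalRightIdeal _ _

/-- In a right strongly exchange ring, a compatible chain of generators has a pair of complementary
idempotents below it. -/
theorem IsRightStronglyExchange.exists_isIdempotentElem (hR : IsRightStronglyExchange R)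
    {ι : Type u} [LinearOrder ι] [WellFoundedLT ι] (g : ι → RightCoprimePair R) (r s : ι → ι → R)
    (hg : ∀ i j, i < j → (g j).a = (g i).a * r i j ∧ (g j).b = (g i).b * s i j)
    (hrs : ∀ i j k, i < j → j < k → r i k = r i j * r j k ∧ s i k = s i j * s j k) :
    ∃ e, IsIdempotentElem e ∧ ∀ i, e ∈ principalRightIdeal (g i).a ∧
      1 - e ∈ principalRightIdeal (g i).b := by
  have hanti : Antitone fun i => (g i).toRCP := by
    refine antitone_iff_forall_lt.2 fun i j hij => RightCoprimePair.toRCP_le_iff.2 ?_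
    exact ⟨principalRightIdeal_le_iff.2 ⟨_, (hg i j hij).1⟩,
      principalRightIdeal_le_iff.2 ⟨_, (hg i j hij).2⟩⟩
  obtain ⟨q, hq, hmin⟩ := hR ι (fun i => (g i).toRCP) ⟨hanti, g, r, s, fun _ => rfl, hg, hrs⟩
  induction q using Quotient.inductionOn with
  | h p =>
    obtain ⟨e, he, hea, heb⟩ := RCP.exists_isIdempotentElem_of_isMin (p := p) hmin
    exact ⟨e, he, fun i => ⟨(RightCoprimePair.toRCP_le_iff.1 (hq i)).1 hea,
      (RightCoprimePair.toRCP_le_iff.1 (hq i)).2 heb⟩⟩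

/-- A right strongly exchange ring is an exchange ring. -/
theorem IsRightStronglyExchange.exists_mul_isIdempotentElem (hR : IsRightStronglyExchange R)
    (x : R) : ∃ y z, IsIdempotentElem (x * y) ∧ 1 - x * y = (1 - x) * z := by
  -- A one-element chain, for which compatibility is vacuous.
  obtain ⟨e, he, h⟩ := hR.exists_isIdempotentElem (ι := PUnit.{u + 1})
    (fun _ => RightCoprimePair.ofAddEqOne x (1 - x) (add_sub_cancel _ _)) (fun _ _ => 1)
    (fun _ _ => 1) (fun i j hij => absurd hij (by simp)) (fun i j k hij => absurd hij (by simp))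
  obtain ⟨y, rfl⟩ := mem_principalRightIdeal.1 (h PUnit.unit).1
  obtain ⟨z, hz⟩ := mem_principalRightIdeal.1 (h PUnit.unit).2
  exact ⟨y, z, he, hz⟩

/-! ### Orthogonal sequences and uncountably many idempotents -/

section OrthogonalSequence

variable {f : ℕ → R}

open Classical in
/-- The sum of the `f i` with `i < n` and `i ∈ A`. -/
noncomputable def partialSumOn (f : ℕ → R) (A : Set ℕ) (n : ℕ) : R :=
  ∑ i ∈ Finset.range n, if i ∈ A then f i else 0

open Classical in
theorem OrthogonalIdempotents.mul_partialSumOn (hf : OrthogonalIdempotents f) (A : Set ℕ)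
    (i n : ℕ) : f i * partialSumOn f A n = if i < n ∧ i ∈ A then f i else 0 := by
  have h (j : ℕ) : f i * (if j ∈ A then f j else 0) = if i = j then (if i ∈ A then f i else 0)
      else 0 := by
    by_cases hij : i = j
    · subst hij
      by_cases hi : i ∈ A <;> simp [hi, (hf.idem i).eq]
    · by_cases hj : j ∈ A <;> simp [hj, hij, hf.ortho hij]
  rw [partialSumOn, Finset.mul_sum, Finset.sum_congr rfl fun j _ => h j, Finset.sum_ite_eq]
  by_cases h1 : i < n <;> by_cases h2 : i ∈ A <;> simp [h1, h2]

theorem OrthogonalIdempotents.partialSumOn_mul_of_le (hf : OrthogonalIdempotents f) (A : Set ℕ)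
    {n m : ℕ} (hnm : n ≤ m) : partialSumOn f A n * partialSumOn f A m = partialSumOn f A n := by
  classical
  conv_lhs => enter [1]; rw [partialSumOn]
  rw [Finset.sum_mul]
  conv_rhs => rw [partialSumOn]
  refine Finset.sum_congr rfl fun i hi => ?_
  by_cases hA : i ∈ A
  · simp [hA, hf.mul_partialSumOn, (Finset.mem_range.1 hi).trans_le hnm]
  · simp [hA]

theorem OrthogonalIdempotents.partialSumOn_mul_compl (hf : OrthogonalIdempotents f) (A : Set ℕ)
    (n m : ℕ) : partialSumOn f A n * partialSumOn f Aᶜ m = 0 := by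
  classical
  conv_lhs => enter [1]; rw [partialSumOn]
  rw [Finset.sum_mul]
  refine Finset.sum_eq_zero fun i _ => ?_
  by_cases hA : i ∈ A
  · simp [hA, hf.mul_partialSumOn]
  · simp [hA]

theorem OrthogonalIdempotents.one_sub_partialSumOn_mul_of_le (hf : OrthogonalIdempotents f)
    (A : Set ℕ) {n m : ℕ} (hnm : n ≤ m) :
    1 - partialSumOn f A m = (1 - partialSumOn f A n) * (1 - partialSumOn f A m) := by
  rw [sub_mul, one_mul, mul_sub, mul_one, hf.partialSumOn_mul_of_le A hnm, sub_self, sub_zero]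

theorem OrthogonalIdempotents.mul_one_sub_partialSumOn (hf : OrthogonalIdempotents f)
    {A : Set ℕ} {i : ℕ} (hi : i ∈ A) : f i * (1 - partialSumOn f A (i + 1)) = 0 := by
  classical
  simp [mul_sub, hf.mul_partialSumOn, hi]

/-- Over a right strongly exchange ring, any set of members of an orthogonal sequence of
idempotents is separated from its complement by an idempotent. -/
theorem IsRightStronglyExchange.exists_separating (hR : IsRightStronglyExchange R)
    (hf : OrthogonalIdempotents f) (A : Set ℕ) :
    ∃ e, IsIdempotentElem e ∧ (∀ i ∈ A, f i * e = 0) ∧ ∀ i ∉ A, f i * e = f i := by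
  let g (n : ULift.{u} ℕ) : RightCoprimePair R :=
    { a := 1 - partialSumOn f A n.down
      b := 1 - partialSumOn f Aᶜ n.down
      -- The two partial sums have product zero, so `(1 - s) * s' + (1 - s') = 1`.
      coprime := principalRightIdeal_sup_eq_top_iff.2 ⟨partialSumOn f Aᶜ n.down, 1, by
        rw [sub_mul, hf.partialSumOn_mul_compl]; noncomm_ring⟩ }
  have : WellFoundedLT (ULift.{u} ℕ) := ⟨InvImage.wf ULift.down wellFounded_lt⟩
  -- Since `a_j = a_i * a_j` for `i < j`, the scalar `r i j` can be `a_j` itself, and compatibility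
  -- is the same identity; likewise for `b`.
  obtain ⟨e, he, h⟩ := hR.exists_isIdempotentElem g (fun _ j => (g j).a) (fun _ j => (g j).b)
    (fun i j hij => ⟨hf.one_sub_partialSumOn_mul_of_le A (le_of_lt hij),
      hf.one_sub_partialSumOn_mul_of_le Aᶜ (le_of_lt hij)⟩)
    (fun i j k _ hjk => ⟨hf.one_sub_partialSumOn_mul_of_le A (le_of_lt hjk),
      hf.one_sub_partialSumOn_mul_of_le Aᶜ (le_of_lt hjk)⟩)
  refine ⟨e, he, fun i hi => ?_, fun i hi => ?_⟩
  · exact mul_eq_zero_of_mem_principalRightIdeal (hf.mul_one_sub_partialSumOn hi) (h ⟨i + 1⟩).1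
  · have := mul_eq_zero_of_mem_principalRightIdeal
      (hf.mul_one_sub_partialSumOn (A := Aᶜ) hi) (h ⟨i + 1⟩).2
    rw [mul_sub, mul_one, sub_eq_zero] at this
    exact this.symm

/-- A right strongly exchange ring with an infinite set of nonzero orthogonal idempotents has
uncountably many idempotents. -/
theorem IsRightStronglyExchange.not_countable_of_orthogonalIdempotents
    (hR : IsRightStronglyExchange R) (hf : OrthogonalIdempotents f) (h0 : ∀ n, f n ≠ 0) :
    ¬ {e : R | IsIdempotentElem e}.Countable := by
  intro hcount
  choose e he h1 h2 using hR.exists_separating hf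
  have := hcount.to_subtype
  have hinj : Function.Injective fun A : Set ℕ => (⟨e A, he A⟩ : {e : R | IsIdempotentElem e}) := by
    intro A B hAB
    have hAB : e A = e B := congrArg Subtype.val hAB
    -- `A` is recovered from `e A` as the set of `i` with `f i * e A = 0`.
    have key (A : Set ℕ) (i : ℕ) : i ∈ A ↔ f i * e A = 0 := by
      refine ⟨h1 A i, fun h => ?_⟩
      by_contra hi
      exact h0 i ((h2 A i hi).symm.trans h)
    ext i
    rw [key A, key B, hAB]
  have : Countable (Set ℕ) := hinj.countable
  obtain ⟨φ, hφ⟩ := exists_injective_nat (Set ℕ)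
  exact Function.cantor_injective φ hφ

end OrthogonalSequence

/-- `d` is an idempotent strictly above `e`. -/
def IdempotentGT (d e : R) : Prop :=
  IsIdempotentElem d ∧ IsIdempotentElem e ∧ e * d = e ∧ d * e = e ∧ d ≠ e

/-- For `n < m`, the difference `e (n + 1) - e n` lies in the corner ring of `e m`, which `e (m + 1)
- e m` annihilates on both sides. -/
theorem orthogonalIdempotents_sub {e : ℕ → R} (he : ∀ n, IsIdempotentElem (e n))
    (h : ∀ n, e n * e (n + 1) = e n ∧ e (n + 1) * e n = e n) :
    OrthogonalIdempotents fun n => e (n + 1) - e n := by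
  have hle {n m : ℕ} (hnm : n ≤ m) : e n * e m = e n ∧ e m * e n = e n := by
    induction m, hnm using Nat.le_induction with
    | base => exact ⟨he n, he n⟩
    | succ m _ ih =>
      constructor
      · rw [← ih.1, mul_assoc, (h m).1]
      · rw [← ih.2, ← mul_assoc, (h m).2]
  have hlt {n m : ℕ} (hnm : n < m) : (e (n + 1) - e n) * (e (m + 1) - e m) = 0 ∧
      (e (m + 1) - e m) * (e (n + 1) - e n) = 0 := by
    have h1 := hle (n := n + 1) (m := m) hnm
    have h2 := hle (n := n + 1) (m := m + 1) (by omega)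
    have h3 := hle (n := n) (m := m) (by omega)
    have h4 := hle (n := n) (m := m + 1) (by omega)
    constructor <;> simp [mul_sub, sub_mul, h1, h2, h3, h4]
  refine ⟨fun n => ?_, fun n m hnm => ?_⟩
  · simp [IsIdempotentElem, mul_sub, sub_mul, h n, (he n).eq, (he (n + 1)).eq]
  · rcases lt_or_gt_of_ne hnm with h | h
    exacts [(hlt h).1, (hlt h).2]

/-- As the relation means "strictly above", this is the ascending chain condition, and minimal
elements for it are maximal idempotents. -/
theorem IsRightStronglyExchange.wellFounded_idempotentGT (hR : IsRightStronglyExchange R)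
    (hcount : {e : R | IsIdempotentElem e}.Countable) :
    WellFounded (IdempotentGT : R → R → Prop) := by
  refine wellFounded_iff_isEmpty_descending_chain.2 ⟨fun ⟨e, he⟩ => ?_⟩
  exact hR.not_countable_of_orthogonalIdempotents
    (orthogonalIdempotents_sub (fun n => (he n).2.1) fun n => ⟨(he n).2.2.1, (he n).2.2.2.1⟩)
    (fun n => sub_ne_zero.2 (he n).2.2.2.2) hcount

/-! ### The quotient by the Jacobson radical -/

/-- A right inverse `u` of `1 + x * y` equals `1 - x * (y * u)`, so it has a right inverse too and
is a two-sided inverse. Then `1 - y * u * x` is a left inverse of `1 + y * x`. -/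
theorem mem_ringJacobson_of_exists_right_inverse {x : R}
    (h : ∀ y, ∃ z, (1 - x * y) * z = 1) : x ∈ Ring.jacobson R := by
  rw [← Ideal.jacobson_bot, Ideal.mem_jacobson_iff]
  intro y
  obtain ⟨u, hu⟩ := h (-y)
  obtain ⟨v, hv⟩ := h (y * u)
  rw [mul_neg, sub_neg_eq_add] at hu
  have hu' : 1 - x * (y * u) = u := by rw [← hu]; noncomm_ring
  rw [hu'] at hv
  have hleft : u * (1 + x * y) = 1 := (left_inv_eq_right_inv hu hv).symm ▸ hv
  refine ⟨1 - y * u * x, ?_⟩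
  rw [Ideal.mem_bot]
  calc (1 - y * u * x) * y * x + (1 - y * u * x) - 1
      = y * x - y * (u * (1 + x * y)) * x := by noncomm_ring
    _ = 0 := by rw [hleft, mul_one, sub_self]

/-- In a right strongly exchange ring, every element outside the Jacobson radical has a nonzero idempotent left
multiple. -/
theorem IsRightStronglyExchange.exists_ne_zero_isIdempotentElem_mul
    (hR : IsRightStronglyExchange R) {x : R} (hx : x ∉ Ring.jacobson R) :
    ∃ w, IsIdempotentElem (w * x) ∧ w * x ≠ 0 := by
  -- The exchange property yields idempotents in `xR`; passing from `x * w` to `(w * x * w) * x`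
  -- moves them to `Rx`.
  suffices ∃ w, IsIdempotentElem (x * w) ∧ x * w ≠ 0 by
    obtain ⟨w, hw, h0⟩ := this
    have hw' : x * w * (x * w) = x * w := hw
    refine ⟨w * (x * w), ?_, fun h => h0 ?_⟩
    · calc w * (x * w) * x * (w * (x * w) * x) = w * ((x * w) * (x * w) * (x * w)) * x := by
            simp only [mul_assoc]
        _ = w * (x * w) * x := by rw [hw', hw']
    · calc x * w = (x * w) * (x * w) * (x * w) := by rw [hw', hw']
        _ = x * (w * (x * w) * x) * w := by simp only [mul_assoc]
        _ = 0 := by rw [h, mul_zero, zero_mul]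
  by_contra! hcon
  refine hx ?_
  have hright (y : R) : ∃ z, (1 - x * y) * z = 1 := by
    obtain ⟨u, z, hu, hz⟩ := hR.exists_mul_isIdempotentElem (x * y)
    have := hcon (y * u) (by rwa [← mul_assoc])
    exact ⟨z, by rw [← hz, mul_assoc, this, sub_zero]⟩
  exact mem_ringJacobson_of_exists_right_inverse hright

/-- Every left ideal is generated modulo the Jacobson radical by an idempotent. -/
theorem IsRightStronglyExchange.exists_isIdempotentElem_mem_ideal
    (hR : IsRightStronglyExchange R) (hcount : {e : R | IsIdempotentElem e}.Countable)
    (I : Ideal R) : ∃ e ∈ I, IsIdempotentElem e ∧ ∀ x ∈ I, x - x * e ∈ Ring.jacobson R := by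
  obtain ⟨e, ⟨heI, he⟩, hmax⟩ := (hR.wellFounded_idempotentGT hcount).has_min
    {e | e ∈ I ∧ IsIdempotentElem e} ⟨0, I.zero_mem, IsIdempotentElem.zero⟩
  refine ⟨e, heI, he, fun x hx => ?_⟩
  by_contra hJ
  obtain ⟨w, hw, h0⟩ := hR.exists_ne_zero_isIdempotentElem_mul hJ
  have hfI : w * (x - x * e) ∈ I := I.mul_mem_left _ (I.sub_mem hx (I.mul_mem_left _ heI))
  have hfe : w * (x - x * e) * e = 0 := by
    rw [mul_assoc, sub_mul, mul_assoc x, he.eq, sub_self, mul_zero]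
  generalize w * (x - x * e) = f at hw h0 hfI hfe
  have hf : f * f = f := hw
  have hee : e * e = e := he
  -- Since `f * e = 0`, `e + f - e * f` is an idempotent of `I` above `e`. If it were `e`, then `e *
  -- f = f` and `f = f * e * f = 0`.
  have h1 : e * (e + (f - e * f)) = e := by
    rw [mul_add, mul_sub, ← mul_assoc, hee, sub_self, add_zero]
  have h2 : (e + (f - e * f)) * e = e := by
    rw [add_mul, sub_mul, mul_assoc e, hfe, hee, mul_zero, sub_zero, add_zero]
  have h3 : (e + (f - e * f)) * f = f := by
    rw [add_mul, sub_mul, mul_assoc e, hf]; abel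
  have h4 : IsIdempotentElem (e + (f - e * f)) := by
    have h5 := mul_add (e + (f - e * f)) e (f - e * f)
    rwa [mul_sub, ← mul_assoc _ e f, h2, h3] at h5
  refine hmax (e + (f - e * f)) ⟨I.add_mem heI (I.sub_mem hfI (I.mul_mem_left _ hfI)), h4⟩
    ⟨h4, he, h1, h2, fun h => h0 ?_⟩
  rw [h] at h3
  rw [← hf]
  nth_rw 2 [← h3]
  rw [← mul_assoc, hfe, zero_mul]

theorem IsRightStronglyExchange.isSemisimpleRing_quotient
    (hR : IsRightStronglyExchange R) (hcount : {e : R | IsIdempotentElem e}.Countable) :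
    IsSemisimpleRing (R ⧸ Ring.jacobson R) := by
  refine (isSemisimpleModule_iff _ _).2 ⟨fun I => ?_⟩
  obtain ⟨e, heI, he, h⟩ := hR.exists_isIdempotentElem_mem_ideal hcount
    (Ideal.comap (Ideal.Quotient.mk (Ring.jacobson R)) I)
  have heI : Ideal.Quotient.mk (Ring.jacobson R) e ∈ I := heI
  have hmul (x : R ⧸ Ring.jacobson R) (hx : x ∈ I) :
      x * Ideal.Quotient.mk (Ring.jacobson R) e = x := by
    obtain ⟨x, rfl⟩ := Ideal.Quotient.mk_surjective x
    rw [← map_mul, eq_comm, Ideal.Quotient.mk_eq_mk_iff_sub_mem]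
    exact h x hx
  have he' := he.map (Ideal.Quotient.mk (Ring.jacobson R))
  generalize Ideal.Quotient.mk (Ring.jacobson R) e = d at heI hmul he'
  -- `d` is an idempotent generating `I`, so `1 - d` generates a complement.
  refine ⟨Ideal.span {1 - d}, ?_⟩
  rw [isCompl_iff, Submodule.disjoint_def, codisjoint_iff, Ideal.eq_top_iff_one]
  refine ⟨fun x hx hx' => ?_, ?_⟩
  · obtain ⟨y, rfl⟩ := Ideal.mem_span_singleton'.1 hx'
    rw [← hmul _ hx, mul_assoc, sub_mul, one_mul, he'.eq, sub_self, mul_zero]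
  · have h1 : d + (1 - d) ∈ I ⊔ Ideal.span {1 - d} :=
      Submodule.add_mem_sup heI (Ideal.mem_span_singleton_self _)
    rwa [add_sub_cancel] at h1

/-- Take an idempotent `e = x * y` with `1 - e ∈ (1 - x)R`. Modulo `I`, `x` annihilates `1 - x`,
hence `1 - e`, so `x = x * e = e`. -/
theorem IsRightStronglyExchange.exists_idempotent_lift (hR : IsRightStronglyExchange R)
    (I : Ideal R) [I.IsTwoSided] (x : R ⧸ I) (hx : IsIdempotentElem x) :
    ∃ e : R, IsIdempotentElem e ∧ Ideal.Quotient.mk I e = x := by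
  obtain ⟨x, rfl⟩ := Ideal.Quotient.mk_surjective x
  obtain ⟨y, z, he, h⟩ := hR.exists_mul_isIdempotentElem x
  refine ⟨x * y, he, ?_⟩
  have h1 := congrArg (Ideal.Quotient.mk I) h
  simp only [map_sub, map_one, map_mul] at h1 ⊢
  generalize Ideal.Quotient.mk I x = a at *
  generalize Ideal.Quotient.mk I y = b at *
  have h2 : a * (1 - a * b) = 0 := by
    rw [h1, ← mul_assoc, mul_sub, mul_one, hx.eq, sub_self, zero_mul]
  rw [mul_sub, mul_one, ← mul_assoc, hx.eq, sub_eq_zero] at h2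
  exact h2.symm

theorem theoremt {R : Type u} [Ring R] (hR : IsRightStronglyExchange R)
    (hcount : {e : R | IsIdempotentElem e}.Countable) : IsSemiperfectRing R :=
  ⟨hR.isSemisimpleRing_quotient hcount, hR.exists_idempotent_lift (Ring.jacobson R)⟩
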